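/- Write $\mathfrak H$ for the upper half-plane, $T=\begin{pmatrix}1&1\\0&1\end{pmatrix}$, $q^x=e^{2\pi i x\tau}$ and $\log q=2\pi i\tau$. Let $\rho:\mathrm{SL}_2(\mathbb Z)\to \mathrm{GL}_p(\mathbb C)$ be a representation, and let $k\in\mathbb Z$. An unrestricted vector-valued modular form of weight $k$ for $\rho$ is a holomorphic map $F=(f_1,\dots,f_p)^t:\mathfrak H\to\mathbb C^p$ with $\rho(\gamma)F(\tau)=(c\tau+d)^{-k}F(\gamma\tau)$ for all $\gamma=\begin{pmatrix}a&b\\c&d\end{pmatrix}\in \mathrm{SL}_2(\mathbb Z)$ and $\tau\in\mathfrak H$. Let $W$ be the span of $f_1,\dots,f_p$. Functions $g_0,\dots,g_{m-1}\in W$ form a modified Jordan block with exponent $\mu\in\mathbb C$ if $g_j(\tau+1)=e^{2\pi i\mu}\,(g_j(\tau)+g_{j-1}(\tau))$ for $0\le j<m$, where $g_{-1}=0$. A polynomial $q$-expansion of such a block consists of $q$-series $h_s(\tau)=\sum_{n\in\mathbb Z}a_s(n)q^{n+\mu}$ ($0\le s<m$), convergent on $\mathfrak H$, with $g_j(\tau)=\sum_{t=0}^{j}\binom{\tau}{t}h_{j-t}(\tau)$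 for $0\le j<m$. A logarithmic $q$-expansion of functions $g_0,\dots,g_{m-1}\in W$ is the same with $(\log q)^t$ in place of $\binom{\tau}{t}$ (and no condition on how the $g_j$ behave under $\tau\mapsto\tau+1$). The form $F$ is a holomorphic (respectively cuspidal) logarithmic vector-valued modular form if $W$ has a basis made up of modified Jordan blocks having polynomial $q$-expansions in which $a_s(n)=0$ whenever $n+\Re\mu<0$ (respectively $n+\Re\mu\le 0$). The Fourier coefficients of $F$ are the coefficients $a_s(n)$ in the polynomial $q$-expansions of modified Jordan blocks in $W$ and in the logarithmic $q$-expansions of functions in $W$. **Theorem.** Suppose that every eigenvalue of $\rho(T)$ has absolute value $1$. Then there is a real constant $\alpha$, depending only on $\rho$, such that for every integer $k$ and every holomorphic logarithmic vector-valued modular form $F$ of weight $k$ for $\rho$, all Fourier coefficients of $F$ satisfy $a(n)=O(n^{k+\alpha})$ as $n\to\infty$; and if $F$ is cuspidal, they satisfy $a(n)=O(n^{(k+\alpha)/2})$ as $n\to\infty$. -/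

import Mathlib

open scoped UpperHalfPlane MatrixGroups Manifold
open Asymptotics Filter

noncomputable section

namespace LogVVMF

/-- An unrestricted vector-valued modular form of integral weight `k` for the matrix representation
`ρ` of `SL(2, ℤ)`: a map `F : ℍ → ℂ ^ p` with holomorphic components such that
`ρ(γ) F(τ) = (c τ + d) ^ (-k) F(γ τ)` for all `γ = (a b; c d)` and all `τ`. -/
structure IsUnrestricted {p : ℕ} (k : ℤ) (ρ : SL(2, ℤ) →* GL (Fin p) ℂ)
    (F : ℍ → Fin p → ℂ) : Prop where
  holomorphic : ∀ l : Fin p, MDifferentiable 𝓘(ℂ) 𝓘(ℂ) (fun τ : ℍ => F τ l)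
  slash : ∀ (γ : SL(2, ℤ)) (τ : ℍ),
    Matrix.mulVec (ρ γ : Matrix (Fin p) (Fin p) ℂ) (F τ) =
      (((γ 1 0 : ℤ) : ℂ) * (τ : ℂ) + ((γ 1 1 : ℤ) : ℂ)) ^ (-k) • F (γ • τ)

/-- The space `W` of functions on `ℍ` spanned by the components of `F`. -/
def componentSpan {p : ℕ} (F : ℍ → Fin p → ℂ) : Submodule ℂ (ℍ → ℂ) :=
  Submodule.span ℂ (Set.range fun (l : Fin p) (τ : ℍ) => F τ l)

/-- The term `a q ^ (n + μ)`, where `q ^ x = exp (2 π i τ x)`. -/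
def qTerm (μ : ℂ) (a : ℤ → ℂ) (τ : ℍ) (n : ℤ) : ℂ :=
  a n * Complex.exp (2 * Real.pi * Complex.I * ((n : ℂ) + μ) * (τ : ℂ))

/-- The `q`-series `∑ n ∈ ℤ, a(n) q ^ (n + μ)`. It is used only when it converges for all `τ`. -/
def qSeries (μ : ℂ) (a : ℤ → ℂ) (τ : ℍ) : ℂ :=
  ∑' n : ℤ, qTerm μ a τ n

/-- The polynomial `x (x - 1) ⋯ (x - t + 1) / t!`. -/
def binom (x : ℂ) (t : ℕ) : ℂ :=
  (∏ i ∈ Finset.range t, (x - (i : ℂ))) / (t.factorial : ℂ)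

/-- The functions `g_0, …, g_{m-1}` are transformed under `τ ↦ τ + 1` by a single modified Jordan
block of size `m` and eigenvalue `exp (2 π i μ)`, that is (with `g_{-1} = 0`)
`g_j(τ + 1) = exp (2 π i μ) (g_j(τ) + g_{j-1}(τ))`. -/
def IsJordanBlock {m : ℕ} (μ : ℂ) (g : Fin m → ℍ → ℂ) : Prop :=
  ∀ (j : Fin m) (τ : ℍ),
    g j ((1 : ℝ) +ᵥ τ) = Complex.exp (2 * Real.pi * Complex.I * μ) *
      (g j τ + if h : (j : ℕ) = 0 then 0 else g ⟨(j : ℕ) - 1, by omega⟩ τ)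

/-- The `q`-series `h_s = ∑ n, a_s(n) q ^ (n + μ)` converge on `ℍ` and
`g_j(τ) = ∑ t ≤ j, b_t(τ) h_{j-t}(τ)` for all `j`. -/
def HasExpansion (b : ℂ → ℕ → ℂ) {m : ℕ} (μ : ℂ) (a : Fin m → ℤ → ℂ)
    (g : Fin m → ℍ → ℂ) : Prop :=
  (∀ (s : Fin m) (τ : ℍ), Summable (qTerm μ (a s) τ)) ∧
  ∀ (j : Fin m) (τ : ℍ),
    g j τ = ∑ t : Fin ((j : ℕ) + 1),
      b (τ : ℂ) (t : ℕ) * qSeries μ (a ⟨(j : ℕ) - (t : ℕ), by omega⟩) τ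

/-- Polynomial `q`-expansions: `g_j(τ) = ∑ t ≤ j, (τ choose t) h_{j-t}(τ)`. -/
def HasPolynomialExpansion {m : ℕ} (μ : ℂ) (a : Fin m → ℤ → ℂ) (g : Fin m → ℍ → ℂ) : Prop :=
  HasExpansion binom μ a g

/-- Logarithmic `q`-expansions: `g_j(τ) = ∑ t ≤ j, (log q) ^ t h_{j-t}(τ)`, `log q = 2 π i τ`. -/
def HasLogarithmicExpansion {m : ℕ} (μ : ℂ) (a : Fin m → ℤ → ℂ) (g : Fin m → ℍ → ℂ) : Prop :=
  HasExpansion (fun x t => (2 * Real.pi * Complex.I * x) ^ t) μ a g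

/-- The space `W` spanned by the components of `F` has a basis `(g_{i,j})` with respect to which
`T` is in modified Jordan canonical form, with polynomial `q`-expansions all of whose Fourier
coefficients `a(n)` belonging to exponents `n + μ` with `V (n + Re μ)` vanish. -/
def VanishesAtInfinityOn {p : ℕ} (F : ℍ → Fin p → ℂ) (V : ℝ → Prop) : Prop :=
  ∃ (r : ℕ) (m : Fin r → ℕ) (μ : Fin r → ℂ) (g : (i : Fin r) → Fin (m i) → ℍ → ℂ)
    (a : (i : Fin r) → Fin (m i) → ℤ → ℂ),
    LinearIndependent ℂ (fun x : (Σ i : Fin r, Fin (m i)) => g x.1 x.2) ∧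
    Submodule.span ℂ (Set.range fun x : (Σ i : Fin r, Fin (m i)) => g x.1 x.2) =
      componentSpan F ∧
    (∀ i, IsJordanBlock (μ i) (g i)) ∧
    (∀ i, HasPolynomialExpansion (μ i) (a i) (g i)) ∧
    ∀ (i : Fin r) (s : Fin (m i)) (n : ℤ), V ((n : ℝ) + (μ i).re) → a i s n = 0

/-- Holomorphic logarithmic vector-valued modular forms of weight `k`, the space `ℋ(k, ρ)`:
the coefficients at exponents with negative real part vanish. -/
def IsHolomorphicForm {p : ℕ} (k : ℤ) (ρ : SL(2, ℤ) →* GL (Fin p) ℂ)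
    (F : ℍ → Fin p → ℂ) : Prop :=
  IsUnrestricted k ρ F ∧ VanishesAtInfinityOn F (fun x => x < 0)

/-- Cuspidal logarithmic vector-valued modular forms: the coefficients at exponents with
nonpositive real part vanish. -/
def IsCuspidalForm {p : ℕ} (k : ℤ) (ρ : SL(2, ℤ) →* GL (Fin p) ℂ)
    (F : ℍ → Fin p → ℂ) : Prop :=
  IsUnrestricted k ρ F ∧ VanishesAtInfinityOn F (fun x => x ≤ 0)

/-- All Fourier coefficients of `F` are `O(n ^ e)` as `n → ∞`. The Fourier coefficients of `F` are
the coefficients of the `q`-series in the expansions of the functions `g_0, …, g_{m-1}` in `W`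
belonging to any modified Jordan block of `T` in `W` (in particular, to a block of a modified Jordan
basis of `W`, or to a block of components of `F` when `ρ(T)` is in modified Jordan canonical form),
and also of the `q`-series in the logarithmic expansions of functions in `W`. -/
def CoefficientsBigO {p : ℕ} (F : ℍ → Fin p → ℂ) (e : ℝ) : Prop :=
  ∀ (m : ℕ) (μ : ℂ) (g : Fin m → ℍ → ℂ) (a : Fin m → ℤ → ℂ),
    (∀ j, g j ∈ componentSpan F) →
    ((IsJordanBlock μ g ∧ HasPolynomialExpansion μ a g) ∨ HasLogarithmicExpansion μ a g) →
    ∀ s : Fin m,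
      (fun n : ℕ => a s (n : ℤ)) =O[atTop] (fun n : ℕ => (n : ℝ) ^ e)

end LogVVMF

end

/-! This is Hecke's argument, with the usual invariance of `‖F‖ * y ^ (k / 2)`, `y = Im τ`, replaced
by monotonicity under reduction towards the fundamental domain. Since the eigenvalues of `ρ(T)` have
modulus 1, `ρ(T) ^ l` grows polynomially in `|l|` (`exists_norm_zpow_mulVec_le`). Take `τ` in the
strip `|Re τ| ≤ 1 / 2` with `y < 1 / 2`, apply `S`, and translate back into the strip. The height is
multiplied by `R = |τ| ^ (-2) ≥ 2`, and the translation has length `O(R ^ (1 / 2))`. So the matrices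
cost at most a power of `R`, and a weight `y ^ (k / 2 + N)` with `N` depending only on `ρ` absorbs
them (`exists_reduction_step`).

Iterating transports growth at the cusp to growth near the real axis (`le_rpow_neg_of_reduction`):
`‖F‖ ≤ C * y ^ c` high up gives `‖F‖ ≤ C * y ^ (-(k + 2 * N + c))` low down, if `c + k / 2 + N ≥ 0`.
A holomorphic form allows `c = p`; a cuspidal form decays exponentially, so `c = -(k / 2 + N)` is
allowed, which halves the exponent. The expansions are triangular, so the `q`-series inherit these
bounds, and the coefficient integral at height `y = 1 / n` finishes (`norm_coeff_le`,
`isBigO_of_forall_norm_le`). -/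

namespace LogVVMF

/-! ### Polynomial growth of powers of a matrix with unimodular spectrum -/

section PolynomialGrowth

variable {E : Type*} [NormedAddCommGroup E] [NormedSpace ℂ E]

/-- The vectors whose orbit under the iterates of `f` grows at most polynomially. -/
def polyGrowth (f : Module.End ℂ E) : Submodule ℂ E where
  carrier := {v | ∃ C : ℝ, ∃ n : ℕ, ∀ l : ℕ, ‖(f ^ l) v‖ ≤ C * (1 + l : ℝ) ^ n}
  zero_mem' := ⟨0, 0, fun l => by simp⟩
  add_mem' := by
    rintro v w ⟨C, n, hv⟩ ⟨D, m, hw⟩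
    refine ⟨|C| + |D|, n + m, fun l => ?_⟩
    have h1 : (1 : ℝ) ≤ 1 + l := by simp
    calc ‖(f ^ l) (v + w)‖ ≤ ‖(f ^ l) v‖ + ‖(f ^ l) w‖ := by rw [map_add]; exact norm_add_le _ _
      _ ≤ C * (1 + l : ℝ) ^ n + D * (1 + l : ℝ) ^ m := add_le_add (hv l) (hw l)
      _ ≤ |C| * (1 + l : ℝ) ^ (n + m) + |D| * (1 + l : ℝ) ^ (n + m) := by
        gcongr <;> first | exact le_abs_self _ | omega
      _ = _ := by ring
  smul_mem' := by
    rintro c v ⟨C, n, hv⟩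
    refine ⟨‖c‖ * C, n, fun l => ?_⟩
    rw [map_smul, norm_smul, mul_assoc]
    exact mul_le_mul_of_nonneg_left (hv l) (norm_nonneg _)

/-- With `w = (f - ev) v` one has `f ^ (l + 1) v = ev • f ^ l v + f ^ l w`. As `|ev| = 1`, the norm
grows at each step by at most the polynomial bound for `w`, and summing costs one degree. -/
lemma mem_polyGrowth_of_pow_apply_eq_zero (f : Module.End ℂ E) {ev : ℂ} (hev : ‖ev‖ = 1) (n : ℕ) :
    ∀ v : E, ((f - algebraMap ℂ (Module.End ℂ E) ev) ^ n) v = 0 → v ∈ polyGrowth f := by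
  induction n with
  | zero =>
    intro v hv
    have : v = 0 := by simpa using hv
    rw [this]; exact zero_mem _
  | succ n ih =>
    intro v hv
    obtain ⟨C, m, hw⟩ := ih ((f - algebraMap ℂ (Module.End ℂ E) ev) v) (by
      rw [pow_succ] at hv; exact hv)
    have hfv : f v = ev • v + (f - algebraMap ℂ (Module.End ℂ E) ev) v := by
      simp [Module.algebraMap_end_apply]
    set w := (f - algebraMap ℂ (Module.End ℂ E) ev) v
    have hC : 0 ≤ C := by simpa using (norm_nonneg _).trans (hw 0)
    refine ⟨‖v‖ + C, m + 1, fun l => ?_⟩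
    have key : ‖(f ^ l) v‖ ≤ ‖v‖ + C * l * (1 + l : ℝ) ^ m := by
      induction l with
      | zero => simp
      | succ l ihl =>
        calc ‖(f ^ (l + 1)) v‖ = ‖ev • (f ^ l) v + (f ^ l) w‖ := by
              rw [pow_succ, Module.End.mul_apply, hfv, map_add, map_smul]
          _ ≤ ‖(f ^ l) v‖ + ‖(f ^ l) w‖ := by
              refine (norm_add_le _ _).trans_eq ?_
              rw [norm_smul, hev, one_mul]
          _ ≤ ‖v‖ + C * l * (1 + l : ℝ) ^ m + C * (1 + l : ℝ) ^ m := add_le_add ihl (hw l)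
          _ = ‖v‖ + C * (l + 1) * (1 + l : ℝ) ^ m := by ring
          _ ≤ ‖v‖ + C * (l + 1) * (1 + (l + 1) : ℝ) ^ m := by gcongr; linarith
          _ = _ := by push_cast; ring
    have h1 : (1 : ℝ) ≤ (1 + l : ℝ) ^ (m + 1) := one_le_pow₀ (by simp)
    calc ‖(f ^ l) v‖ ≤ ‖v‖ * 1 + C * l * (1 + l : ℝ) ^ m := by rw [mul_one]; exact key
      _ ≤ ‖v‖ * (1 + l : ℝ) ^ (m + 1) + C * (1 + l) * (1 + l : ℝ) ^ m := by gcongr; linarith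
      _ = _ := by ring

lemma polyGrowth_eq_top [FiniteDimensional ℂ E] (f : Module.End ℂ E)
    (hf : ∀ ev : ℂ, f.HasEigenvalue ev → ‖ev‖ = 1) : polyGrowth f = ⊤ := by
  rw [eq_top_iff, ← Module.End.iSup_maxGenEigenspace_eq_top f, iSup_le_iff]
  intro ev v hv
  rw [Module.End.mem_maxGenEigenspace] at hv
  obtain ⟨n, hn⟩ := hv
  by_cases hev : f.HasEigenvalue ev
  · exact mem_polyGrowth_of_pow_apply_eq_zero f (hf ev hev) n v (by
      simpa [Algebra.algebraMap_eq_smul_one] using hn)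
  · have hv0 : v ∈ f.genEigenspace ev n := by
      rw [Module.End.mem_genEigenspace_nat]; exact hn
    have : f.genEigenspace ev n = ⊥ := by
      by_contra h
      exact hev (Module.End.hasEigenvalue_of_hasGenEigenvalue (k := n) h)
    rw [this] at hv0
    rw [(Submodule.mem_bot ℂ).1 hv0]
    exact zero_mem _

lemma exists_norm_pow_apply_le {p : ℕ} (f : Module.End ℂ (Fin p → ℂ))
    (hf : ∀ ev : ℂ, f.HasEigenvalue ev → ‖ev‖ = 1) :
    ∃ C : ℝ, 0 ≤ C ∧ ∃ n : ℕ, ∀ (l : ℕ) (v : Fin p → ℂ),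
      ‖(f ^ l) v‖ ≤ C * (1 + l : ℝ) ^ n * ‖v‖ := by
  have h : ∀ i : Fin p, Pi.single i (1 : ℂ) ∈ polyGrowth f := fun i => by
    rw [polyGrowth_eq_top f hf]; trivial
  choose C n hC using h
  refine ⟨∑ i, |C i|, Finset.sum_nonneg fun i _ => abs_nonneg _, ∑ i, n i, fun l v => ?_⟩
  have hv : v = ∑ i, v i • (Pi.single i (1 : ℂ) : Fin p → ℂ) := by
    ext j; simp [Finset.sum_apply, Pi.single_apply]
  have h1 : (1 : ℝ) ≤ 1 + l := by simp
  calc ‖(f ^ l) v‖ = ‖∑ i, v i • (f ^ l) (Pi.single i (1 : ℂ))‖ := by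
        conv_lhs => rw [hv]
        simp [map_sum]
    _ ≤ ∑ i, ‖v i • (f ^ l) (Pi.single i (1 : ℂ))‖ := norm_sum_le _ _
    _ ≤ ∑ i, |C i| * (1 + l : ℝ) ^ (∑ i, n i) * ‖v‖ := by
        refine Finset.sum_le_sum fun i _ => ?_
        rw [norm_smul, mul_comm]
        refine mul_le_mul ?_ (norm_le_pi_norm v i) (norm_nonneg _) (by positivity)
        refine (hC i l).trans ?_
        gcongr
        · exact le_abs_self _
        · exact Finset.single_le_sum (f := n) (fun _ _ => Nat.zero_le _) (Finset.mem_univ i)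
    _ = _ := by rw [← Finset.sum_mul, ← Finset.sum_mul]

/-- Integer powers of an invertible matrix with eigenvalues of absolute value `1` grow at most
polynomially. -/
lemma exists_norm_zpow_mulVec_le {p : ℕ} (A : GL (Fin p) ℂ)
    (hA : ∀ ev : ℂ, Module.End.HasEigenvalue
      (Matrix.toLin' (A : Matrix (Fin p) (Fin p) ℂ)) ev → ‖ev‖ = 1) :
    ∃ C : ℝ, 0 ≤ C ∧ ∃ n : ℕ, ∀ (l : ℤ) (v : Fin p → ℂ),
      ‖Matrix.mulVec ((A ^ l : GL (Fin p) ℂ) : Matrix (Fin p) (Fin p) ℂ) v‖ ≤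
        C * (1 + |(l : ℝ)|) ^ n * ‖v‖ := by
  -- Negative powers are powers of the inverse, whose eigenvalues are inverses of those of `A` and
  -- so again have modulus 1.
  have hA' : ∀ ev : ℂ, Module.End.HasEigenvalue
      (Matrix.toLin' ((A⁻¹ : GL (Fin p) ℂ) : Matrix (Fin p) (Fin p) ℂ)) ev → ‖ev‖ = 1 := by
    intro ev hev
    obtain ⟨v, hv⟩ := hev.exists_hasEigenvector
    have h1 := hv.apply_eq_smul
    rw [Matrix.toLin'_apply] at h1
    have h2 : v = ev • Matrix.mulVec (A : Matrix (Fin p) (Fin p) ℂ) v := by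
      rw [← Matrix.mulVec_smul, ← h1, Matrix.mulVec_mulVec, ← Units.val_mul, mul_inv_cancel]
      simp
    have hev0 : ev ≠ 0 := by
      rintro rfl
      exact hv.2 (by rw [h2, zero_smul])
    have h3 : ‖ev⁻¹‖ = 1 := by
      refine hA _ (Module.End.hasEigenvalue_of_hasEigenvector (x := v)
        ⟨Module.End.mem_eigenspace_iff.2 ?_, hv.2⟩)
      rw [Matrix.toLin'_apply]
      conv_rhs => rw [h2]
      rw [smul_smul, inv_mul_cancel₀ hev0, one_smul]
    rwa [norm_inv, inv_eq_one] at h3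
  obtain ⟨C, hC0, n, hC⟩ := exists_norm_pow_apply_le _ hA
  obtain ⟨D, hD0, m, hD⟩ := exists_norm_pow_apply_le _ hA'
  refine ⟨C + D, by positivity, n + m, fun l v => ?_⟩
  obtain ⟨j, rfl | rfl⟩ := l.eq_nat_or_neg
  · have h := hC j v
    rw [← Matrix.toLin'_pow, Matrix.toLin'_apply] at h
    rw [zpow_natCast, Units.val_pow_eq_pow_val]
    refine h.trans ?_
    simp only [Int.cast_natCast, Nat.abs_cast]
    gcongr
    · linarith
    · simp
    · omega
  · have h := hD j v
    rw [← Matrix.toLin'_pow, Matrix.toLin'_apply] at h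
    rw [zpow_neg, zpow_natCast, ← inv_pow, Units.val_pow_eq_pow_val]
    refine h.trans ?_
    simp only [Int.cast_neg, abs_neg, Int.cast_natCast, Nat.abs_cast]
    gcongr
    · linarith
    · simp
    · omega

lemma exists_norm_mulVec_le {p : ℕ} (A : Matrix (Fin p) (Fin p) ℂ) :
    ∃ C : ℝ, 0 ≤ C ∧ ∀ v : Fin p → ℂ, ‖A.mulVec v‖ ≤ C * ‖v‖ :=
  ⟨‖LinearMap.toContinuousLinearMap (Matrix.toLin' A)‖, norm_nonneg _, fun v =>
    (LinearMap.toContinuousLinearMap (Matrix.toLin' A)).le_opNorm v⟩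

end PolynomialGrowth

/-! ### Reduction towards the fundamental domain -/

section Reduction

lemma IsUnrestricted.apply_T_zpow_smul {p : ℕ} {k : ℤ} {ρ : SL(2, ℤ) →* GL (Fin p) ℂ}
    {F : ℍ → Fin p → ℂ} (hF : IsUnrestricted k ρ F) (l : ℤ) (τ : ℍ) :
    F (ModularGroup.T ^ l • τ) =
      Matrix.mulVec ((ρ ModularGroup.T ^ l : GL (Fin p) ℂ) : Matrix (Fin p) (Fin p) ℂ) (F τ) := by
  have h := hF.slash (ModularGroup.T ^ l) τ
  simpa [ModularGroup.coe_T_zpow, map_zpow] using h.symm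

lemma IsUnrestricted.apply_eq_S_smul {p : ℕ} {k : ℤ} {ρ : SL(2, ℤ) →* GL (Fin p) ℂ}
    {F : ℍ → Fin p → ℂ} (hF : IsUnrestricted k ρ F) (τ : ℍ) :
    F τ = (τ : ℂ) ^ (-k) • Matrix.mulVec
      (((ρ ModularGroup.S)⁻¹ : GL (Fin p) ℂ) : Matrix (Fin p) (Fin p) ℂ)
        (F (ModularGroup.S • τ)) := by
  have h := hF.slash ModularGroup.S τ
  have h2 : (((ModularGroup.S 1 0 : ℤ) : ℂ) * (τ : ℂ) + ((ModularGroup.S 1 1 : ℤ) : ℂ)) = τ := by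
    simp [ModularGroup.coe_S]
  rw [h2] at h
  rw [← Matrix.mulVec_smul, ← h, Matrix.mulVec_mulVec, ← Units.val_mul, inv_mul_cancel]
  simp

/-- One step of the reduction towards the fundamental domain: the weighted norm of `F` does not
decrease, and the imaginary part is at least doubled. -/
lemma exists_reduction_step {p : ℕ} (ρ : SL(2, ℤ) →* GL (Fin p) ℂ)
    (hρ : ∀ ev : ℂ, Module.End.HasEigenvalue
      (Matrix.toLin' (ρ ModularGroup.T : Matrix (Fin p) (Fin p) ℂ)) ev → ‖ev‖ = 1) :
    ∃ N : ℝ, 0 ≤ N ∧ ∀ (k : ℤ) (F : ℍ → Fin p → ℂ), IsUnrestricted k ρ F →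
      ∀ τ : ℍ, |τ.re| ≤ 1 / 2 → τ.im < 1 / 2 →
        ∃ σ : ℍ, |σ.re| ≤ 1 / 2 ∧ 2 * τ.im ≤ σ.im ∧ σ.im * τ.im ≤ 1 ∧
          ‖F τ‖ * τ.im ^ ((k : ℝ) / 2 + N) ≤ ‖F σ‖ * σ.im ^ ((k : ℝ) / 2 + N) := by
  obtain ⟨C, hC0, M, hC⟩ := exists_norm_zpow_mulVec_le _ hρ
  obtain ⟨D, hD0, hD⟩ := exists_norm_mulVec_le
    (((ρ ModularGroup.S)⁻¹ : GL (Fin p) ℂ) : Matrix (Fin p) (Fin p) ℂ)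
  -- The constants are absorbed by `R ^ N`, because `R ≥ 2`; the extra `M / 2` below pays for `(1 +
  -- |l|) ^ M ≤ (3 * R ^ (1 / 2)) ^ M`. Both are fixed before `k` and `F`.
  obtain ⟨N, hN⟩ := pow_unbounded_of_one_lt (D * C * 3 ^ M) (one_lt_two : (1 : ℝ) < 2)
  refine ⟨(N : ℝ) + (M : ℝ) / 2, by positivity, fun k F hF τ hre him => ?_⟩
  have hy : 0 < τ.im := τ.im_pos
  set r : ℝ := ‖(τ : ℂ)‖ with hr
  have hr2 : r ^ 2 = τ.re ^ 2 + τ.im ^ 2 := by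
    rw [hr, Complex.sq_norm, Complex.normSq_apply]; simp [sq]
  have hr0 : 0 < r := norm_pos_iff.2 (UpperHalfPlane.ne_zero τ)
  have hr2' : r ^ 2 ≤ 1 / 2 := by
    have := sq_le_sq' (abs_le.1 hre).1 (abs_le.1 hre).2
    nlinarith
  have hr1 : r ≤ 1 := by nlinarith
  have hSim : (ModularGroup.S • τ).im = τ.im / r ^ 2 := by
    rw [UpperHalfPlane.modular_S_smul, ← UpperHalfPlane.coe_im]
    simp [Complex.inv_im, hr, Complex.sq_norm, neg_div]
  have hSre : |(ModularGroup.S • τ).re| ≤ 1 / r := by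
    rw [UpperHalfPlane.modular_S_smul]
    refine (Complex.abs_re_le_norm _).trans_eq ?_
    simp [hr]
  set τ₁ := ModularGroup.S • τ with hτ₁
  set l : ℤ := round τ₁.re with hl
  set σ : ℍ := ModularGroup.T ^ (-l) • τ₁ with hσ
  have hσre : σ.re = τ₁.re - l := by
    rw [hσ, UpperHalfPlane.modular_T_zpow_smul, UpperHalfPlane.vadd_re]; push_cast; ring
  have hσim : σ.im = τ.im / r ^ 2 := by
    rw [hσ, UpperHalfPlane.modular_T_zpow_smul, UpperHalfPlane.vadd_im, hSim]
  have hround : |τ₁.re - l| ≤ 1 / 2 := abs_sub_round _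
  have hr1' : 1 ≤ 1 / r := by rw [le_div_iff₀ hr0]; linarith
  have hlabs : 1 + |(l : ℝ)| ≤ 3 / r := by
    have h1 : |(l : ℝ)| ≤ |τ₁.re| + |τ₁.re - l| := by
      have := abs_sub τ₁.re (τ₁.re - l)
      rwa [sub_sub_cancel] at this
    have h2 : (3 : ℝ) / r = 1 / r + 2 * (1 / r) := by ring
    linarith
  have hτ₁σ : τ₁ = ModularGroup.T ^ l • σ := by
    rw [hσ, smul_smul, ← zpow_add]; simp
  set R : ℝ := 1 / r ^ 2 with hR
  have hR2 : 2 ≤ R := by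
    rw [hR, le_div_iff₀ (by positivity)]; linarith
  have hR0 : 0 < R := by linarith
  have hrR : 1 / r = R ^ (1 / 2 : ℝ) := by
    rw [← Real.sqrt_eq_rpow, hR, Real.sqrt_div zero_le_one, Real.sqrt_one, Real.sqrt_sq hr0.le]
  have hσR : σ.im = R * τ.im := by rw [hσim, hR]; ring
  refine ⟨σ, by rwa [hσre], ?_, ?_, ?_⟩
  · rw [hσR]; gcongr
  · rw [hσim, div_mul_eq_mul_div, div_le_one (by positivity), hr2]
    nlinarith [sq_nonneg τ.re]
  have hFτ : ‖F τ‖ ≤ R ^ ((k : ℝ) / 2) * (D * (C * (3 / r) ^ M * ‖F σ‖)) := by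
    rw [hF.apply_eq_S_smul τ, norm_smul, norm_zpow]
    have h1 : ‖(τ : ℂ)‖ ^ (-k) = R ^ ((k : ℝ) / 2) := by
      rw [← hr, zpow_neg, ← inv_zpow, ← one_div, hrR, ← Real.rpow_intCast, ← Real.rpow_mul hR0.le]
      congr 1; ring
    rw [h1]
    gcongr
    refine (hD _).trans ?_
    gcongr
    rw [← hτ₁, hτ₁σ, hF.apply_T_zpow_smul]
    refine (hC _ _).trans ?_
    gcongr
  have hpow : D * C * (3 / r) ^ M ≤ R ^ ((N : ℝ) + (M : ℝ) / 2) := by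
    have h1 : (3 / r) ^ M = 3 ^ M * R ^ ((M : ℝ) / 2) := by
      rw [show (3 : ℝ) / r = 3 * (1 / r) by ring, mul_pow, hrR, ← Real.rpow_natCast (R ^ _),
        ← Real.rpow_mul hR0.le]
      congr 2; ring
    rw [h1, Real.rpow_add hR0, ← mul_assoc, Real.rpow_natCast]
    gcongr
    exact hN.le.trans (by gcongr)
  calc ‖F τ‖ * τ.im ^ ((k : ℝ) / 2 + (N + M / 2))
      ≤ R ^ ((k : ℝ) / 2) * (D * (C * (3 / r) ^ M * ‖F σ‖)) *
        τ.im ^ ((k : ℝ) / 2 + (N + M / 2)) := by gcongr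
    _ = (D * C * (3 / r) ^ M) * R ^ ((k : ℝ) / 2) * ‖F σ‖ *
        τ.im ^ ((k : ℝ) / 2 + (N + M / 2)) := by ring
    _ ≤ R ^ ((N : ℝ) + (M : ℝ) / 2) * R ^ ((k : ℝ) / 2) * ‖F σ‖ *
        τ.im ^ ((k : ℝ) / 2 + (N + M / 2)) := by gcongr
    _ = ‖F σ‖ * (R * τ.im) ^ ((k : ℝ) / 2 + (N + M / 2)) := by
        rw [Real.mul_rpow hR0.le hy.le, Real.rpow_add hR0 (k / 2)]; ring
    _ = _ := by rw [hσR]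

/-- A function that does not decrease along the reduction steps is controlled on the strip
`|Re τ| ≤ 1 / 2` by its growth at the cusp. -/
lemma le_rpow_neg_of_reduction {u : ℍ → ℝ}
    (hu : ∀ τ : ℍ, |τ.re| ≤ 1 / 2 → τ.im < 1 / 2 →
      ∃ σ : ℍ, |σ.re| ≤ 1 / 2 ∧ 2 * τ.im ≤ σ.im ∧ σ.im * τ.im ≤ 1 ∧ u τ ≤ u σ)
    {C e : ℝ} (hC : 0 ≤ C) (he : 0 ≤ e)
    (hcusp : ∀ τ : ℍ, |τ.re| ≤ 1 / 2 → 1 / 2 ≤ τ.im → u τ ≤ C * τ.im ^ e)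
    (τ : ℍ) (hre : |τ.re| ≤ 1 / 2) (him : τ.im < 1 / 2) : u τ ≤ C * τ.im ^ (-e) := by
  -- Heights at least double, so `n` bounds the number of steps that stay below height `1 / 2`.
  obtain ⟨n, hn⟩ := pow_unbounded_of_one_lt (1 / τ.im) (one_lt_two : (1 : ℝ) < 2)
  have hn' : 1 < τ.im * 2 ^ n := by
    rwa [div_lt_iff₀ τ.im_pos, mul_comm] at hn
  clear hn
  induction n generalizing τ with
  | zero => rw [pow_zero, mul_one] at hn'; linarith
  | succ n ih =>
    obtain ⟨σ, hσre, hσ2, hσ1, hσ⟩ := hu τ hre him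
    refine hσ.trans ?_
    have hτ0 := τ.im_pos
    rcases lt_or_ge σ.im (1 / 2) with h | h
    · refine (ih σ hσre h (hn'.trans_le ?_)).trans ?_
      · rw [pow_succ', ← mul_assoc, mul_comm τ.im]; gcongr
      · gcongr C * ?_
        exact Real.rpow_le_rpow_of_nonpos hτ0 (by linarith) (by linarith)
    -- The path has just left the low region: `Im σ ≤ 1 / Im τ` turns the exponent `e` at the cusp
    -- into `-e`.
    · refine (hcusp σ hσre h).trans ?_
      gcongr C * ?_
      rw [Real.rpow_neg hτ0.le, ← Real.inv_rpow hτ0.le]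
      refine Real.rpow_le_rpow σ.im_pos.le ?_ he
      rw [← one_div, le_div_iff₀ hτ0]
      exact hσ1

end Reduction

/-! ### From functions to `q`-series and coefficients -/

section Expansions

open Real in
lemma norm_qTerm (μ : ℂ) (a : ℤ → ℂ) (τ : ℍ) (n : ℤ) :
    ‖qTerm μ a τ n‖ = ‖a n‖ * exp (-(2 * π * (((n : ℝ) + μ.re) * τ.im + μ.im * τ.re))) := by
  rw [qTerm, norm_mul, Complex.norm_exp]
  congr 2
  simp [Complex.mul_re, Complex.mul_im]
  ring

open Real in
/-- If all exponents are at least `δ` then the `q`-series is `O(exp (-2 π δ y))` on the strip. -/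
lemma exists_norm_qSeries_le {μ : ℂ} {a : ℤ → ℂ} (hs : ∀ τ, Summable (qTerm μ a τ)) {δ : ℝ}
    (ha : ∀ n : ℤ, (n : ℝ) + μ.re < δ → a n = 0) :
    ∃ C : ℝ, 0 ≤ C ∧ ∀ τ : ℍ, |τ.re| ≤ 1 / 2 → 1 / 2 ≤ τ.im →
      ‖qSeries μ a τ‖ ≤ C * exp (-(2 * π * δ * τ.im)) := by
  -- Termwise comparison with the point `i / 2`: an exponent at least `δ` gives a decay factor of at
  -- most `exp (-2 π δ (y - 1 / 2))`, and `Im μ` costs a bounded factor on the strip.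
  set σ : ℍ := ⟨⟨0, 1 / 2⟩, by norm_num⟩ with hσ
  have hσre : σ.re = 0 := rfl
  have hσim : σ.im = 1 / 2 := rfl
  refine ⟨exp (π * |μ.im| + π * δ) * ∑' n, ‖qTerm μ a σ n‖, by positivity, fun τ hre him => ?_⟩
  rw [mul_right_comm, ← tsum_mul_left]
  refine tsum_of_norm_bounded ((hs σ).norm.mul_left _).hasSum fun n => ?_
  rw [norm_qTerm, norm_qTerm, hσre, hσim]
  rcases lt_or_ge ((n : ℝ) + μ.re) δ with h | h
  · simp [ha n h]
  · rw [mul_left_comm, ← exp_add, ← exp_add]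
    gcongr
    have h1 : -(μ.im * τ.re) ≤ |μ.im| * (1 / 2) := by
      refine (neg_le_abs _).trans ?_
      rw [abs_mul]; gcongr
    have h2 : δ * (τ.im - 1 / 2) ≤ ((n : ℝ) + μ.re) * (τ.im - 1 / 2) := by
      gcongr
    nlinarith [pi_pos]

lemma norm_coe_le (τ : ℍ) : ‖(τ : ℂ)‖ ≤ |τ.re| + τ.im := by
  simpa [abs_of_pos τ.im_pos] using Complex.norm_le_abs_re_add_abs_im (τ : ℂ)

lemma norm_binom_le (x : ℂ) (t : ℕ) : ‖binom x t‖ ≤ (‖x‖ + t) ^ t := by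
  have h1 : (1 : ℝ) ≤ t.factorial := by exact_mod_cast t.factorial_pos
  rw [binom, norm_div, Complex.norm_natCast, norm_prod]
  refine (div_le_self (Finset.prod_nonneg fun _ _ => norm_nonneg _) h1).trans ?_
  calc ∏ i ∈ Finset.range t, ‖x - (i : ℂ)‖ ≤ ∏ _i ∈ Finset.range t, (‖x‖ + t) := by
        refine Finset.prod_le_prod (fun _ _ => norm_nonneg _) fun i hi => ?_
        refine (norm_sub_le _ _).trans ?_
        rw [Complex.norm_natCast]
        gcongr
        exact (Finset.mem_range.1 hi).le
    _ = _ := by simp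

lemma exists_norm_apply_le_of_expansion {m p : ℕ} (hm : m ≤ p) {μ : ℂ} {a : Fin m → ℤ → ℂ}
    {g : Fin m → ℍ → ℂ} (hg : HasPolynomialExpansion μ a g) {δ : ℝ}
    (ha : ∀ s (n : ℤ), (n : ℝ) + μ.re < δ → a s n = 0) (j : Fin m) :
    ∃ C : ℝ, 0 ≤ C ∧ ∀ τ : ℍ, |τ.re| ≤ 1 / 2 → 1 / 2 ≤ τ.im →
      ‖g j τ‖ ≤ C * (τ.im ^ p * Real.exp (-(2 * Real.pi * δ * τ.im))) := by
  choose C hC0 hC using fun s => exists_norm_qSeries_le (hg.1 s) (ha s)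
  refine ⟨∑ t : Fin ((j : ℕ) + 1), (2 + 2 * (p : ℝ)) ^ p * C ⟨(j : ℕ) - (t : ℕ), by omega⟩,
    Finset.sum_nonneg fun t _ => mul_nonneg (by positivity) (hC0 _), fun τ hre him => ?_⟩
  rw [hg.2 j τ, Finset.sum_mul]
  refine (norm_sum_le _ _).trans (Finset.sum_le_sum fun t _ => ?_)
  have htp : (t : ℕ) ≤ p := by omega
  have hb : ‖binom (τ : ℂ) t‖ ≤ (2 + 2 * (p : ℝ)) ^ p * τ.im ^ p := by
    refine (norm_binom_le _ _).trans ?_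
    rw [← mul_pow]
    have htp' : ((t : ℕ) : ℝ) ≤ p := by exact_mod_cast htp
    have hp : (p : ℝ) ≤ 2 * p * τ.im := by nlinarith [(Nat.cast_nonneg p : (0 : ℝ) ≤ p)]
    have h1 : ‖(τ : ℂ)‖ + (t : ℕ) ≤ (2 + 2 * (p : ℝ)) * τ.im := by
      have := norm_coe_le τ
      linarith
    refine (pow_le_pow_left₀ (by positivity) h1 _).trans ?_
    refine pow_le_pow_right₀ ?_ htp
    nlinarith [(Nat.cast_nonneg p : (0 : ℝ) ≤ p)]
  rw [norm_mul]
  refine (mul_le_mul hb (hC _ τ hre him) (norm_nonneg _) (by positivity)).trans_eq (by ring)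

lemma norm_apply_le_norm_of_mem {p : ℕ} {F : ℍ → Fin p → ℂ} {f : ℍ → ℂ}
    (hf : f ∈ componentSpan F) : ∃ C : ℝ, 0 ≤ C ∧ ∀ τ, ‖f τ‖ ≤ C * ‖F τ‖ := by
  obtain ⟨c, rfl⟩ := (Submodule.mem_span_range_iff_exists_fun ℂ).1 hf
  refine ⟨∑ i, ‖c i‖, by positivity, fun τ => ?_⟩
  rw [Finset.sum_apply, Finset.sum_mul]
  refine (norm_sum_le _ _).trans (Finset.sum_le_sum fun i _ => ?_)
  rw [Pi.smul_apply, smul_eq_mul, norm_mul]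
  gcongr
  exact norm_le_pi_norm (F τ) i

/-- Growth of a form at the cusp, from the vanishing of its coefficients. The exponent `δ`
may depend on the block. -/
lemma exists_norm_le_of_vanishes {p : ℕ} {F : ℍ → Fin p → ℂ} {V : ℝ → Prop}
    (hF : VanishesAtInfinityOn F V) {w : ℝ → ℝ} (hw0 : ∀ y, 1 / 2 ≤ y → 0 ≤ w y)
    (hw : ∀ x : ℝ, ∃ δ : ℝ, (∀ n : ℤ, (n : ℝ) + x < δ → V ((n : ℝ) + x)) ∧
      ∃ C : ℝ, 0 ≤ C ∧ ∀ y, 1 / 2 ≤ y → y ^ p * Real.exp (-(2 * Real.pi * δ * y)) ≤ C * w y) :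
    ∃ C : ℝ, 0 ≤ C ∧ ∀ τ : ℍ, |τ.re| ≤ 1 / 2 → 1 / 2 ≤ τ.im → ‖F τ‖ ≤ C * w τ.im := by
  obtain ⟨r, m, μ, g, a, hli, hspan, -, hexp, hV⟩ := hF
  -- Linear independence bounds the block sizes by `dim W ≤ p`, so the binomials contribute at most
  -- `y ^ p`, uniformly over all forms.
  have hcard : ∑ i, m i ≤ p := by
    have hmem : ∀ x : (Σ i : Fin r, Fin (m i)), g x.1 x.2 ∈ componentSpan F := fun x => by
      rw [← hspan]; exact Submodule.subset_span ⟨x, rfl⟩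
    have hfin : FiniteDimensional ℂ (componentSpan F) :=
      FiniteDimensional.span_of_finite ℂ (Set.finite_range _)
    have h1 := (finrank_span_eq_card hli).symm
    rw [hspan] at h1
    have h2 : Module.finrank ℂ (componentSpan F) ≤ p :=
      (finrank_range_le_card (R := ℂ) (fun (l : Fin p) (τ : ℍ) => F τ l)).trans_eq
        (Fintype.card_fin p)
    simpa using h1.trans_le h2
  have hm : ∀ i, m i ≤ p := fun i =>
    (Finset.single_le_sum (f := m) (fun _ _ => Nat.zero_le _) (Finset.mem_univ i)).trans hcard
  have hg : ∀ x : (Σ i : Fin r, Fin (m i)), ∃ C : ℝ, 0 ≤ C ∧ ∀ τ : ℍ, |τ.re| ≤ 1 / 2 →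
      1 / 2 ≤ τ.im → ‖g x.1 x.2 τ‖ ≤ C * w τ.im := by
    rintro ⟨i, j⟩
    obtain ⟨δ, hδ, C, hC0, hC⟩ := hw (μ i).re
    obtain ⟨D, hD0, hD⟩ := exists_norm_apply_le_of_expansion (hm i) (hexp i)
      (fun s n hn => hV i s n (hδ n hn)) j
    refine ⟨D * C, by positivity, fun τ hre him => (hD τ hre him).trans ?_⟩
    rw [mul_assoc D]
    exact mul_le_mul_of_nonneg_left (hC _ him) hD0
  choose D hD0 hD using hg
  have hcomp : ∀ l : Fin p, ∃ C : ℝ, 0 ≤ C ∧ ∀ τ : ℍ, |τ.re| ≤ 1 / 2 →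
      1 / 2 ≤ τ.im → ‖F τ l‖ ≤ C * w τ.im := by
    intro l
    have hl : (fun τ => F τ l) ∈ componentSpan F := Submodule.subset_span ⟨l, rfl⟩
    rw [← hspan, Submodule.mem_span_range_iff_exists_fun] at hl
    obtain ⟨c, hc⟩ := hl
    refine ⟨∑ x, ‖c x‖ * D x, Finset.sum_nonneg fun x _ => mul_nonneg (norm_nonneg _) (hD0 x),
      fun τ hre him => ?_⟩
    rw [← congrFun hc τ, Finset.sum_apply, Finset.sum_mul]
    refine (norm_sum_le _ _).trans (Finset.sum_le_sum fun x _ => ?_)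
    rw [Pi.smul_apply, smul_eq_mul, norm_mul, mul_assoc]
    gcongr
    exact hD x τ hre him
  choose B hB0 hB using hcomp
  refine ⟨∑ l, B l, Finset.sum_nonneg fun l _ => hB0 l, fun τ hre him => ?_⟩
  have hw0' := hw0 _ him
  refine (pi_norm_le_iff_of_nonneg
    (mul_nonneg (Finset.sum_nonneg fun l _ => hB0 l) hw0')).2 fun l => ?_
  refine (hB l τ hre him).trans ?_
  gcongr
  exact Finset.single_le_sum (f := B) (fun l _ => hB0 l) (Finset.mem_univ l)

/-- The `q`-series in an expansion are bounded by the functions that they expand. -/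
lemma exists_norm_qSeries_le_of_expansion {b : ℂ → ℕ → ℂ} (hb0 : ∀ x, b x 0 = 1)
    (hb : ∀ t, ∃ B : ℝ, ∀ x : ℂ, ‖x‖ ≤ 1 → ‖b x t‖ ≤ B) {m : ℕ} {μ : ℂ} {a : Fin m → ℤ → ℂ}
    {g : Fin m → ℍ → ℂ} (hg : HasExpansion b μ a g) {u : ℍ → ℝ} {P : ℍ → Prop}
    (hP : ∀ τ, P τ → ‖(τ : ℂ)‖ ≤ 1)
    (hgu : ∀ j, ∃ C : ℝ, ∀ τ, P τ → ‖g j τ‖ ≤ C * u τ) (s : Fin m) :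
    ∃ C : ℝ, ∀ τ, P τ → ‖qSeries μ (a s) τ‖ ≤ C * u τ := by
  obtain ⟨s, hs⟩ := s
  induction s using Nat.strong_induction_on with
  | _ s ih =>
  choose B hB using hb
  obtain ⟨D, hD⟩ := hgu ⟨s, hs⟩
  have ih' : ∀ t : Fin s, ∃ C : ℝ, ∀ τ, P τ →
      ‖qSeries μ (a ⟨s - (t + 1), by omega⟩) τ‖ ≤ C * u τ :=
    fun t => ih (s - (t + 1)) (by omega) (by omega)
  choose C hC using ih'
  refine ⟨D + ∑ t : Fin s, B (t + 1) * C t, fun τ hτ => ?_⟩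
  -- The system is triangular with unit diagonal: `h_s` is `g_s` minus terms in the earlier `h_{s -
  -- t}`, `t ≥ 1`.
  have h := hg.2 ⟨s, hs⟩ τ
  rw [Fin.sum_univ_succ] at h
  simp only [Fin.val_zero, hb0, one_mul, Nat.sub_zero, Fin.val_succ] at h
  rw [← sub_eq_iff_eq_add] at h
  rw [← h, add_mul, Finset.sum_mul]
  refine (norm_sub_le _ _).trans (add_le_add (hD τ hτ) ?_)
  refine (norm_sum_le _ _).trans (Finset.sum_le_sum fun t _ => ?_)
  rw [norm_mul, mul_assoc]
  have hBt := hB (t + 1) τ (hP τ hτ)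
  exact mul_le_mul hBt (hC t τ hτ) (norm_nonneg _) ((norm_nonneg _).trans hBt)

lemma integral_exp_two_pi_mul (n : ℤ) (y : ℝ) :
    ∫ x in (-(1 / 2) : ℝ)..(1 / 2),
      Complex.exp (2 * Real.pi * Complex.I * n * ((x : ℂ) + y * Complex.I)) =
        if n = 0 then 1 else 0 := by
  split_ifs with h
  · subst h; simp; norm_num
  · have hc : 2 * Real.pi * Complex.I * (n : ℂ) ≠ 0 := by
      simp [Real.pi_ne_zero, Complex.I_ne_zero, h]
    simp_rw [mul_add, Complex.exp_add]
    rw [intervalIntegral.integral_mul_const, integral_exp_mul_complex hc]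
    have : Complex.exp (2 * Real.pi * Complex.I * n * ((1 / 2 : ℝ) : ℂ)) =
        Complex.exp (2 * Real.pi * Complex.I * n * ((-(1 / 2) : ℝ) : ℂ)) := by
      rw [Complex.exp_eq_exp_iff_exists_int]
      exact ⟨n, by push_cast; ring⟩
    rw [this]; simp

/-- The estimate of the coefficients of a `q`-series by its values on a horizontal segment. -/
lemma norm_coeff_le {μ : ℂ} {a : ℤ → ℂ} (hs : ∀ τ, Summable (qTerm μ a τ)) {y B : ℝ}
    (hy : 0 < y) (hB : ∀ τ : ℍ, |τ.re| ≤ 1 / 2 → τ.im = y → ‖qSeries μ a τ‖ ≤ B) (n : ℤ) :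
    ‖a n‖ ≤ B * Real.exp (2 * Real.pi * ((n : ℝ) + μ.re) * y + Real.pi * |μ.im|) := by
  let z : ℝ → ℍ := fun x => ⟨(x : ℂ) + y * Complex.I, by simpa using hy⟩
  have hzre : ∀ x, (z x).re = x := fun x => by rw [← UpperHalfPlane.coe_re]; simp [z]
  have hzim : ∀ x, (z x).im = y := fun x => by rw [← UpperHalfPlane.coe_im]; simp [z]
  -- This is `q ^ (-(n + μ))`. The product with the series involves only integral powers of `q`, so
  -- integrating over a period isolates `a n`.
  let E : ℝ → ℂ := fun x =>
    Complex.exp (-(2 * Real.pi * Complex.I * ((n : ℂ) + μ) * ((x : ℂ) + y * Complex.I)))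
  have hE : ∀ x : ℝ, ‖E x‖ = Real.exp (2 * Real.pi * (((n : ℝ) + μ.re) * y + μ.im * x)) := by
    intro x
    simp only [E]
    rw [Complex.norm_exp]
    congr 1
    simp [Complex.mul_re, Complex.mul_im]
    ring
  have hterm : ∀ (l : ℤ) (x : ℝ), qTerm μ a (z x) l * E x =
      a l * Complex.exp (2 * Real.pi * Complex.I * ((l - n : ℤ) : ℂ) *
        ((x : ℂ) + y * Complex.I)) := by
    intro l x
    simp only [qTerm, E, z]
    rw [mul_assoc, ← Complex.exp_add]
    congr 2
    push_cast
    ring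
  -- The dependence of the norms on `x` through `Im μ` cancels, so the terms at `x = 0` dominate the
  -- whole segment.
  have hnorm : ∀ (l : ℤ) (x : ℝ), ‖qTerm μ a (z x) l * E x‖ =
      ‖qTerm μ a (z 0) l‖ * ‖E 0‖ := by
    intro l x
    rw [norm_mul, norm_qTerm, norm_qTerm, hE, hE, hzre, hzre, hzim, hzim,
      mul_assoc ‖a l‖, mul_assoc ‖a l‖, ← Real.exp_add, ← Real.exp_add]
    congr 2
    ring
  have hsum := intervalIntegral.hasSum_integral_of_dominated_convergence
    (μ := MeasureTheory.volume) (a := (-(1 / 2) : ℝ)) (b := 1 / 2)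
    (F := fun (l : ℤ) (x : ℝ) => qTerm μ a (z x) l * E x)
    (f := fun x => qSeries μ a (z x) * E x)
    (fun l _ => ‖qTerm μ a (z 0) l‖ * ‖E 0‖)
    (fun l => by
      simp_rw [hterm]
      exact Continuous.aestronglyMeasurable (by fun_prop))
    (fun l => Eventually.of_forall fun x _ => (hnorm l x).le)
    (Eventually.of_forall fun x _ => (hs (z 0)).norm.mul_right _)
    (by simp)
    (Eventually.of_forall fun x _ => (hs (z x)).hasSum.mul_right _)
  simp_rw [hterm, intervalIntegral.integral_const_mul, integral_exp_two_pi_mul] at hsum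
  have hval : a n = ∫ x in (-(1 / 2) : ℝ)..(1 / 2), qSeries μ a (z x) * E x := by
    refine (hasSum_single n fun l hl => ?_).unique hsum |>.symm.trans ?_ |>.symm
    all_goals simp [sub_eq_zero]
    all_goals try exact fun h => absurd h hl
  have hB0 : 0 ≤ B := (norm_nonneg _).trans (hB (z 0) (by rw [hzre]; norm_num) (hzim 0))
  rw [hval]
  refine (intervalIntegral.norm_integral_le_of_norm_le_const fun x hx => ?_).trans_eq
    (show _ * |(1 / 2 : ℝ) - (-(1 / 2))| = _ by norm_num; rfl)
  rw [Set.uIoc_of_le (by norm_num)] at hx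
  have hx' : |x| ≤ 1 / 2 := abs_le.2 ⟨by linarith [hx.1], hx.2⟩
  rw [norm_mul, hE]
  gcongr
  · exact hB _ (by rwa [hzre]) (hzim x)
  · have h1 : μ.im * x ≤ |μ.im| * (1 / 2) := by
      refine (le_abs_self _).trans ?_
      rw [abs_mul]; gcongr
    nlinarith [Real.pi_pos]

end Expansions

/-! ### Coefficient bounds and behaviour at the cusp -/

section Coefficients

/-- On the low part of the strip `|τ| ≤ 1`, so the binomials or powers of `log q` are bounded and
the `q`-series grow no faster there than `F`. -/
lemma exists_norm_coeff_le {p : ℕ} {F : ℍ → Fin p → ℂ} {C e : ℝ}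
    (hF : ∀ τ : ℍ, |τ.re| ≤ 1 / 2 → τ.im < 1 / 2 → ‖F τ‖ ≤ C * τ.im ^ (-e))
    {b : ℂ → ℕ → ℂ} (hb0 : ∀ x, b x 0 = 1)
    (hb : ∀ t, ∃ B : ℝ, ∀ x : ℂ, ‖x‖ ≤ 1 → ‖b x t‖ ≤ B) {m : ℕ} {μ : ℂ} {a : Fin m → ℤ → ℂ}
    {g : Fin m → ℍ → ℂ} (hgF : ∀ j, g j ∈ componentSpan F) (hg : HasExpansion b μ a g)
    (s : Fin m) :
    ∃ D : ℝ, ∀ (n : ℤ) (y : ℝ), 0 < y → y < 1 / 2 →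
      ‖a s n‖ ≤ D * y ^ (-e) *
        Real.exp (2 * Real.pi * ((n : ℝ) + μ.re) * y + Real.pi * |μ.im|) := by
  obtain ⟨D, hD⟩ := exists_norm_qSeries_le_of_expansion hb0 hb hg (u := fun τ => τ.im ^ (-e))
    (P := fun τ => |τ.re| ≤ 1 / 2 ∧ τ.im < 1 / 2)
    (fun τ hτ => (norm_coe_le τ).trans (by linarith [hτ.1, hτ.2]))
    (fun j => by
      obtain ⟨B, hB0, hB⟩ := norm_apply_le_norm_of_mem (hgF j)
      refine ⟨B * C, fun τ hτ => (hB τ).trans ?_⟩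
      rw [mul_assoc]
      exact mul_le_mul_of_nonneg_left (hF τ hτ.1 hτ.2) hB0) s
  refine ⟨D, fun n y hy hy2 => norm_coeff_le (hg.1 s) hy (fun τ hre him => ?_) n⟩
  rw [← him]
  exact hD τ ⟨hre, him ▸ hy2⟩

/-- Put `y = 1 / n`: the exponential stays bounded and `y ^ (-e) = n ^ e`. Taking `n ≥ 3` ensures `y
< 1 / 2`. -/
lemma isBigO_of_forall_norm_le {a : ℤ → ℂ} {D e c d : ℝ}
    (h : ∀ (n : ℤ) (y : ℝ), 0 < y → y < 1 / 2 →
      ‖a n‖ ≤ D * y ^ (-e) * Real.exp (2 * Real.pi * ((n : ℝ) + c) * y + d)) :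
    (fun n : ℕ => a (n : ℤ)) =O[atTop] (fun n : ℕ => (n : ℝ) ^ e) := by
  refine IsBigO.of_bound (D * Real.exp (2 * Real.pi * (1 + |c|) + d)) ?_
  filter_upwards [eventually_ge_atTop 3] with n hn
  have hn3 : (3 : ℝ) ≤ n := by exact_mod_cast hn
  have hn0 : (0 : ℝ) < n := by linarith
  have hn1 : (n : ℝ)⁻¹ < 1 / 2 := by
    rw [one_div]; exact inv_strictAnti₀ two_pos (by linarith)
  have h1 := h n (n : ℝ)⁻¹ (by positivity) hn1
  rw [Real.inv_rpow hn0.le, Real.rpow_neg hn0.le, inv_inv, Int.cast_natCast] at h1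
  have hD : 0 ≤ D := by
    have h2 : 0 ≤ D * ((n : ℝ) ^ e *
        Real.exp (2 * Real.pi * ((n : ℝ) + c) * (n : ℝ)⁻¹ + d)) := by
      rw [← mul_assoc]; exact (norm_nonneg _).trans h1
    exact nonneg_of_mul_nonneg_left h2 (by positivity)
  rw [Real.norm_of_nonneg (by positivity)]
  rw [mul_right_comm] at h1
  refine h1.trans ?_
  gcongr D * Real.exp (?_ + d) * _
  rw [mul_assoc]
  gcongr
  rw [add_mul, mul_inv_cancel₀ hn0.ne']
  gcongr
  calc c * (n : ℝ)⁻¹ ≤ |c| * (n : ℝ)⁻¹ := by gcongr; exact le_abs_self c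
    _ ≤ |c| * 1 := by gcongr; linarith
    _ = _ := mul_one _

lemma eq_zero_of_forall_norm_le {z : ℂ} {D e c d : ℝ} (he : e < 0)
    (h : ∀ y : ℝ, 0 < y → y < 1 / 2 → ‖z‖ ≤ D * y ^ (-e) * Real.exp (c * y + d)) : z = 0 := by
  have hlim : Tendsto (fun y : ℝ => D * y ^ (-e) * Real.exp (c * y + d)) (nhdsWithin 0 (Set.Ioi 0))
      (nhds 0) := by
    have h1 : Continuous fun y : ℝ => D * y ^ (-e) * Real.exp (c * y + d) :=
      (continuous_const.mul (Real.continuous_rpow_const (by linarith))).mul (by fun_prop)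
    have h2 := h1.tendsto 0
    rw [Real.zero_rpow (by linarith), mul_zero, zero_mul] at h2
    exact h2.mono_left nhdsWithin_le_nhds
  have h3 : ‖z‖ ≤ 0 := by
    refine ge_of_tendsto hlim ?_
    filter_upwards [Ioo_mem_nhdsGT (show (0 : ℝ) < 1 / 2 by norm_num)] with y hy
    exact h y hy.1 hy.2
  exact norm_le_zero_iff.1 h3

lemma exists_norm_binom_le (t : ℕ) : ∃ B : ℝ, ∀ x : ℂ, ‖x‖ ≤ 1 → ‖binom x t‖ ≤ B :=
  ⟨(1 + t) ^ t, fun x hx => (norm_binom_le x t).trans (by gcongr)⟩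

lemma exists_norm_log_pow_le (t : ℕ) :
    ∃ B : ℝ, ∀ x : ℂ, ‖x‖ ≤ 1 → ‖(2 * Real.pi * Complex.I * x) ^ t‖ ≤ B := by
  refine ⟨(2 * Real.pi) ^ t, fun x hx => ?_⟩
  rw [norm_pow]
  gcongr
  rw [norm_mul]
  have : ‖(2 * Real.pi * Complex.I : ℂ)‖ = 2 * Real.pi := by simp [abs_of_pos Real.pi_pos]
  rw [this]
  exact mul_le_of_le_one_right (by positivity) hx

/-- If `e < 0`, letting `y → 0` kills every coefficient, so any `e'` is allowed; this serves very
negative weights. -/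
lemma coefficientsBigO_of_norm_le {p : ℕ} {F : ℍ → Fin p → ℂ} {C e e' : ℝ}
    (hF : ∀ τ : ℍ, |τ.re| ≤ 1 / 2 → τ.im < 1 / 2 → ‖F τ‖ ≤ C * τ.im ^ (-e))
    (he : e ≤ e' ∨ e < 0) : CoefficientsBigO F e' := by
  intro m μ g a hgF hg s
  have hD : ∃ D : ℝ, ∀ (n : ℤ) (y : ℝ), 0 < y → y < 1 / 2 →
      ‖a s n‖ ≤ D * y ^ (-e) *
        Real.exp (2 * Real.pi * ((n : ℝ) + μ.re) * y + Real.pi * |μ.im|) := by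
    rcases hg with ⟨-, hg⟩ | hg
    · exact exists_norm_coeff_le hF (fun x => by simp [binom]) exists_norm_binom_le hgF hg s
    · exact exists_norm_coeff_le hF (fun x => pow_zero _) exists_norm_log_pow_le hgF hg s
  obtain ⟨D, hD⟩ := hD
  rcases he with he | he
  · refine (isBigO_of_forall_norm_le hD).trans (IsBigO.of_bound 1 ?_)
    filter_upwards [eventually_ge_atTop 1] with n hn
    have hn1 : (1 : ℝ) ≤ n := by exact_mod_cast hn
    rw [Real.norm_of_nonneg (by positivity), Real.norm_of_nonneg (by positivity), one_mul]
    exact Real.rpow_le_rpow_of_exponent_le hn1 he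
  · have h0 : ∀ n, a s n = 0 := fun n => eq_zero_of_forall_norm_le he (hD n)
    simpa [h0] using isBigO_zero (fun n : ℕ => (n : ℝ) ^ e') atTop

lemma exists_pow_mul_exp_neg_le (p : ℕ) {b : ℝ} (hb : 0 < b) (c : ℝ) :
    ∃ C : ℝ, 0 ≤ C ∧ ∀ y : ℝ, 1 / 2 ≤ y → y ^ p * Real.exp (-(b * y)) ≤ C * y ^ c := by
  have h1 := tendsto_rpow_mul_exp_neg_mul_atTop_nhds_zero ((p : ℝ) - c) b hb
  obtain ⟨Y, hY⟩ := eventually_atTop.1 (h1.eventually_le_const (zero_lt_one))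
  have hcont : ContinuousOn (fun y : ℝ => y ^ ((p : ℝ) - c) * Real.exp (-b * y))
      (Set.Icc (1 / 2) Y) := by
    refine ContinuousOn.mul (fun y hy => ?_) (by fun_prop)
    exact (Real.continuousAt_rpow_const y _ (Or.inl (by linarith [hy.1]))).continuousWithinAt
  obtain ⟨D, hD⟩ := isCompact_Icc.exists_bound_of_continuousOn hcont
  refine ⟨1 + |D|, by positivity, fun y hy => ?_⟩
  have hy0 : 0 < y := by linarith
  have key : y ^ ((p : ℝ) - c) * Real.exp (-b * y) ≤ 1 + |D| := by
    rcases le_total Y y with h | h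
    · exact (hY y h).trans (by linarith [abs_nonneg D])
    · exact (le_abs_self _).trans ((hD y ⟨hy, h⟩).trans (by linarith [le_abs_self D]))
  calc y ^ p * Real.exp (-(b * y)) = (y ^ ((p : ℝ) - c) * Real.exp (-b * y)) * y ^ c := by
        rw [mul_right_comm, ← Real.rpow_add hy0, sub_add_cancel, Real.rpow_natCast, neg_mul]
    _ ≤ _ := by gcongr

lemma IsHolomorphicForm.exists_norm_le {p : ℕ} {k : ℤ} {ρ : SL(2, ℤ) →* GL (Fin p) ℂ}
    {F : ℍ → Fin p → ℂ} (hF : IsHolomorphicForm k ρ F) :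
    ∃ C : ℝ, 0 ≤ C ∧ ∀ τ : ℍ, |τ.re| ≤ 1 / 2 → 1 / 2 ≤ τ.im → ‖F τ‖ ≤ C * τ.im ^ (p : ℝ) :=
  exists_norm_le_of_vanishes hF.2 (w := fun y => y ^ (p : ℝ))
    (fun y hy => Real.rpow_nonneg (by linarith) _)
    fun x => ⟨0, fun n hn => hn, 1, zero_le_one, fun y _ => by simp⟩

lemma IsCuspidalForm.exists_norm_le {p : ℕ} {k : ℤ} {ρ : SL(2, ℤ) →* GL (Fin p) ℂ}
    {F : ℍ → Fin p → ℂ} (hF : IsCuspidalForm k ρ F) (c : ℝ) :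
    ∃ C : ℝ, 0 ≤ C ∧ ∀ τ : ℍ, |τ.re| ≤ 1 / 2 → 1 / 2 ≤ τ.im → ‖F τ‖ ≤ C * τ.im ^ c := by
  refine exists_norm_le_of_vanishes hF.2 (w := fun y => y ^ c)
    (fun y hy => Real.rpow_nonneg (by linarith) _)
    -- This is the least positive element of `x + ℤ`; a smaller exponent in this coset is
    -- nonpositive. It gives exponential decay, which beats every power of `y`.
    fun x => ⟨x - ⌈x⌉ + 1, fun n hn => ?_, exists_pow_mul_exp_neg_le p ?_ c⟩
  · have h1 : (n : ℝ) < 1 - ⌈x⌉ := by linarith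
    have h2 : n ≤ -⌈x⌉ := by
      have : n < 1 - ⌈x⌉ := by exact_mod_cast h1
      omega
    have h3 : (n : ℝ) ≤ -⌈x⌉ := by exact_mod_cast h2
    linarith [Int.le_ceil x]
  · have := Int.ceil_lt_add_one x
    have h : 0 < x - ⌈x⌉ + 1 := by linarith
    positivity

end Coefficients

end LogVVMF

/-! ### The coefficient estimates -/

theorem theorem3p6 {p : ℕ} (ρ : SL(2, ℤ) →* GL (Fin p) ℂ)
    (hρ : ∀ ev : ℂ, Module.End.HasEigenvalue
      (Matrix.toLin' (ρ ModularGroup.T : Matrix (Fin p) (Fin p) ℂ)) ev → ‖ev‖ = 1) :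
    ∃ α : ℝ, ∀ (k : ℤ) (F : ℍ → Fin p → ℂ),
      (LogVVMF.IsHolomorphicForm k ρ F → LogVVMF.CoefficientsBigO F ((k : ℝ) + α)) ∧
      (LogVVMF.IsCuspidalForm k ρ F → LogVVMF.CoefficientsBigO F (((k : ℝ) + α) / 2)) := by
  obtain ⟨N, hN0, hN⟩ := LogVVMF.exists_reduction_step ρ hρ
  refine ⟨2 * N + p, fun k F => ?_⟩
  have key : LogVVMF.IsUnrestricted k ρ F → ∀ C c : ℝ, 0 ≤ C →
      (∀ τ : ℍ, |τ.re| ≤ 1 / 2 → 1 / 2 ≤ τ.im → ‖F τ‖ ≤ C * τ.im ^ c) →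
      0 ≤ c + ((k : ℝ) / 2 + N) →
      ∀ τ : ℍ, |τ.re| ≤ 1 / 2 → τ.im < 1 / 2 → ‖F τ‖ ≤ C * τ.im ^ (-((k : ℝ) + 2 * N + c)) := by
    intro hF C c hC0 hC hc τ hre him
    have h := LogVVMF.le_rpow_neg_of_reduction
      (u := fun τ => ‖F τ‖ * τ.im ^ ((k : ℝ) / 2 + N)) (hN k F hF) hC0 hc
      (fun τ hre him => by
        rw [Real.rpow_add τ.im_pos c, ← mul_assoc]
        have := τ.im_pos
        gcongr
        exact hC τ hre him) τ hre him
    have hy := τ.im_pos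
    rw [← le_div_iff₀ (by positivity), mul_div_assoc, ← Real.rpow_sub hy] at h
    refine h.trans_eq ?_
    congr 2
    ring
  have hp : (0 : ℝ) ≤ p := Nat.cast_nonneg p
  refine ⟨fun hF => ?_, fun hF => ?_⟩
  · obtain ⟨C, hC0, hC⟩ := hF.exists_norm_le
    rcases le_or_gt 0 ((p : ℝ) + ((k : ℝ) / 2 + N)) with h | h
    · exact LogVVMF.coefficientsBigO_of_norm_le (key hF.1 C p hC0 hC h) (Or.inl (by linarith))
    -- The weight is too negative for `c = p`. Enlarging `c` to `-(k / 2 + N) > p` costs only a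
    -- constant, since `y ≥ 1 / 2`; the exponent becomes `k / 2 + N < 0`, so all coefficients
    -- vanish.
    · refine LogVVMF.coefficientsBigO_of_norm_le
        (key hF.1 (C * (1 / 2) ^ ((p : ℝ) - -((k : ℝ) / 2 + N))) (-((k : ℝ) / 2 + N)) (by positivity) ?_
          (by linarith)) (Or.inr (by linarith))
      intro τ hre him
      refine (hC τ hre him).trans ?_
      rw [mul_assoc]
      gcongr
      rw [← sub_add_cancel (p : ℝ) (-((k : ℝ) / 2 + N)), Real.rpow_add τ.im_pos,
        sub_add_cancel]
      have := τ.im_pos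
      gcongr ?_ * _
      exact Real.rpow_le_rpow_of_nonpos (by norm_num) him (by linarith)
  -- This `c` makes the weighted norm bounded at the cusp, hence on the whole strip; the exponent is
  -- `k / 2 + N ≤ (k + α) / 2`.
  · obtain ⟨C, hC0, hC⟩ := hF.exists_norm_le (-((k : ℝ) / 2 + N))
    exact LogVVMF.coefficientsBigO_of_norm_le (key hF.1 C _ hC0 hC (by linarith))
      (Or.inl (by linarith))
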